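/- Let $G$ be a non-compact locally compact Hausdorff abelian group, written additively, whose topology is first countable (equivalently, metrizable), and let $H\subsetneq G$ be a proper open compact subgroup. For $g\in C(G)$ (continuous functions $G\to\mathbb C$) and $x,s\in G$ write $T_xg(y)=g(y-x)$ and $g_s=\overline{g}\cdot T_sg$. Then there are $g\in C(G)$ and a uniformly separated set $\Lambda\subseteq G$ (that is, for some neighbourhood $U$ of $0$ every translate of $U$ contains at most one element of $\Lambda$) such that: 1. for every compact $K\subseteq H$ and every $s\in K-K$, the system $\{T_xg_s\}_{x\in\Lambda}$ is complete in $C(K)$, i.e. the linear span of the restrictions $T_xg_s|_K$, $x\in\Lambda$, is dense in $C(K)$ for the supremum norm; 2. if, moreover, $G$ is dually expansible, then for every compact $K\subseteq G$ and every $s\in K-K$ the system $\{T_xg_s\}_{x\in\Lambda}$ is complete in $C(K)$. Here a locally compact abelian group $X$ is called expansible if there are an open compact subgroup $H'\subseteq X$ and a topological group automorphism $A$ of $X$ with $H'\subsetneq AH'$ and $\bigcap_{n\le 0}A^nH'=\{0\}$, and $G$ is called dually expansible if its Pontryagin dual $\widehat G$ is expansible. -/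

import Mathlib

open scoped Pointwise Topology

/-- `Λ` is uniformly separated: for some neighbourhood `U` of `0`, every translate of `U` contains
at most one element of `Λ`. -/
def IsUniformlySeparated {G : Type*} [AddCommGroup G] [TopologicalSpace G] (Λ : Set G) : Prop :=
  ∃ U ∈ 𝓝 (0 : G), ∀ a : G, ((a +ᵥ U) ∩ Λ).Subsingleton

/-- The translate `T_x f`, that is `y ↦ f (y - x)`. -/
noncomputable def translateMap {G : Type*} [AddCommGroup G] [TopologicalSpace G] [IsTopologicalAddGroup G]
    (x : G) (f : C(G, ℂ)) : C(G, ℂ) where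
  toFun y := f (y - x)
  continuous_toFun := by fun_prop

/-- The function `g_s = conj g * T_s g`. -/
noncomputable def windowProduct {G : Type*} [AddCommGroup G] [TopologicalSpace G] [IsTopologicalAddGroup G]
    (g : C(G, ℂ)) (s : G) : C(G, ℂ) :=
  star g * translateMap s g

/-- The system `f` is complete in `C(K)`: the linear span of the restrictions to `K` is dense.
For compact `K` the topology of `C(K, ℂ)` (the compact-open one) is that of the sup norm. -/
def IsCompleteOn {G ι : Type*} [TopologicalSpace G] (f : ι → C(G, ℂ)) (K : Set G) : Prop :=
  (Submodule.span ℂ (Set.range fun i => (f i).restrict K)).topologicalClosure = ⊤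

/-- `A` is expansive with respect to the open compact subgroup `H`: `H ⊊ A H`, and the
intersection of the `A⁻ⁿ H` over `n ≥ 0` is trivial. -/
structure IsExpansive {G : Type*} [AddCommGroup G] [TopologicalSpace G]
    (A : G ≃ₜ+ G) (H : AddSubgroup G) : Prop where
  isOpen : IsOpen (H : Set G)
  isCompact : IsCompact (H : Set G)
  ssubset_image : (H : Set G) ⊂ A '' (H : Set G)
  iInter_eq : ⋂ n : ℕ, (⇑A.symm)^[n] '' (H : Set G) = {0}

/-- `G` has an expansive topological automorphism with respect to some open compact subgroup. -/
def IsExpansible (G : Type*) [AddCommGroup G] [TopologicalSpace G] : Prop :=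
  ∃ (H : AddSubgroup G) (A : G ≃ₜ+ G), IsExpansive A H

/-- The Pontryagin dual of `G` is expansible. (Mathlib's dual is that of a multiplicative group and
is written multiplicatively, whence the two changes of notation.) -/
def IsDuallyExpansible (G : Type*) [AddCommGroup G] [TopologicalSpace G] : Prop :=
  IsExpansible (Additive (PontryaginDual (Multiplicative G)))

/-!
The functions `g_s` are not required to decay, so `g` may be prescribed freely and independently on
infinitely many disjoint pieces of `G`, and `Λ` only has to pick out the pieces.

The quotient `Q = G ⧸ H` is discrete and infinite. It has exactly `#Q` finite subsets `F`, so a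
transfinite recursion along a well-order of type `(#Q).ord` produces, for every `F`, every
`k : ℕ` and every `j : Fin 4`, a point `x` of `G` such that the finite sets `F - [x]` are pairwise
disjoint in `Q` (`exists_injective_sub_disjoint`). In particular the points `x` lie in distinct
cosets of `H`, so the set `Λ` of all of them is uniformly separated.

The preimage of `F` in `G` is compact and metrizable. Hence there are `f₀, f₁, …` in `C(G, ℂ)` whose
restrictions to any compact `K` over `F` are dense in `C(K)`
(`ContinuousMap.exists_seq_denseRange_restrict`). As the sets `F - [x]` are disjoint, there is a
continuous `g` with `g (y - x) = 1 + I ^ j * conj (f_k y)` for all `y` over `F`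
(`exists_continuousMap_translates`). Given a compact `K` and any `s` in `G`, let `F` be the image of
`K ∪ (K - s)` in `Q`. The polarization identity
`∑ j, I ^ j * conj (1 + I ^ j * a) * (1 + I ^ j * b) = 4 * conj a`
(`Complex.sum_I_pow_mul_conj_mul`), applied to `a = conj (f_k y)` and `b = conj (f_k (y - s))`,
shows that on `K` each `f_k` is a linear combination of four of the translates `T_x g_s`, and
density follows.
-/

open Cardinal in
/-- If the index set `ι` is infinite and no larger than `Q`, then any family of finite subsets of `Q`
indexed by `ι` becomes pairwise disjoint under a suitable family of distinct translations. The
translations are chosen by recursion along a well-order of `ι` in which every proper initial segment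
has cardinality less than `#ι`: each earlier choice excludes only finitely many values, so the
excluded values do not exhaust `Q`. -/
theorem exists_injective_sub_disjoint.{u} {ι Q : Type u} [AddCommGroup Q] [Infinite ι]
    (hcard : #ι ≤ #Q) (F : ι → Finset Q) :
    ∃ q : ι → Q, Function.Injective q ∧
      ∀ i j z, z + q i ∈ F i → z + q j ∈ F j → i = j := by
  classical
  obtain ⟨_, _, hord⟩ := exists_ord_eq_type_lt ι
  -- The values that the choice `q j = p` excludes for a later index `i`: the point `p` itself, for
  -- injectivity, and the `p + (F i - F j)`, for which the translates would meet. The second condition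
  -- is symmetric in `i` and `j`, so it is enough to avoid it at the later index.
  let bad (i j : ι) (p : Q) : Finset Q := insert p ((F i - F j).image fun d => p + d)
  have step (i : ι) (p : ∀ j, j < i → Q) : ∃ a : Q, ∀ j (h : j < i), a ∉ bad i j (p j h) := by
    by_contra! hall
    have hcover : (Set.univ : Set Q) ⊆ ⋃ j : Set.Iio i, (bad i j (p j j.2) : Set Q) := by
      intro a _
      obtain ⟨j, hj, ha⟩ := hall a
      exact Set.mem_iUnion.2 ⟨⟨j, hj⟩, ha⟩
    have hlt : #(Set.Iio i) < #ι := mk_Iio_lt i hord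
    -- Finitely many earlier choices exclude a finite set; infinitely many exclude a set no larger
    -- than the initial segment.
    rcases lt_or_ge #(Set.Iio i) ℵ₀ with hfin | hinf
    · have := lt_aleph0_iff_finite.1 hfin
      have : Infinite Q := infinite_iff.2 ((aleph0_le_mk ι).trans hcard)
      exact Set.infinite_univ
        ((Set.finite_iUnion fun j : Set.Iio i => Finset.finite_toSet _).subset hcover)
    · refine (hcard.trans ?_).not_gt hlt
      calc #Q = #(Set.univ : Set Q) := mk_univ.symm
        _ ≤ #(⋃ j : Set.Iio i, (bad i j (p j j.2) : Set Q)) := mk_le_mk_of_subset hcover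
        _ ≤ #(Set.Iio i) * ⨆ j : Set.Iio i, #(bad i j (p j j.2) : Set Q) := mk_iUnion_le _
        _ ≤ #(Set.Iio i) * ℵ₀ := by
          gcongr
          exact ciSup_le' fun j => (Finset.finite_toSet _).lt_aleph0.le
        _ = #(Set.Iio i) := mul_aleph0_eq hinf
  let q : ι → Q := wellFounded_lt.fix fun i p => (step i p).choose
  have hq (i j : ι) (h : j < i) : q i ∉ bad i j (q j) := by
    have : q i = (step i fun j _ => q j).choose := wellFounded_lt.fix_eq _ i
    rw [this]
    exact (step i fun j _ => q j).choose_spec j h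
  refine ⟨q, fun i j hij => ?_, fun i j z hi hj => ?_⟩
  · rcases lt_trichotomy i j with h | h | h
    · exact absurd (Finset.mem_insert.2 (.inl hij.symm)) (hq j i h)
    · exact h
    · exact absurd (Finset.mem_insert.2 (.inl hij)) (hq i j h)
  · have key (i j : ι) (hi : z + q i ∈ F i) (hj : z + q j ∈ F j) : q i ∈ bad i j (q j) :=
      Finset.mem_insert_of_mem (Finset.mem_image.2
        ⟨_, Finset.sub_mem_sub hi hj, by abel⟩)
    rcases lt_trichotomy i j with h | h | h
    · exact absurd (key j i hj hi) (hq j i h)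
    · exact h
    · exact absurd (key i j hi hj) (hq i j h)

/-- Over a compact subset `L` of a metrizable space, one sequence of continuous functions serves all
closed `K ⊆ L`: the separable space `C(L, ℂ)` maps continuously onto each `C(K, ℂ)`. -/
theorem ContinuousMap.exists_seq_denseRange_restrict {X : Type*} [TopologicalSpace X]
    [TopologicalSpace.MetrizableSpace X] {L : Set X} (hL : IsCompact L) :
    ∃ f : ℕ → C(X, ℂ), ∀ K ⊆ L, IsClosed K → DenseRange fun k => (f k).restrict K := by
  have : CompactSpace L := isCompact_iff_compactSpace.1 hL
  let _ := TopologicalSpace.metrizableSpaceMetric X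
  choose f hf using fun k =>
    ContinuousMap.exists_restrict_eq hL.isClosed (TopologicalSpace.denseSeq C(L, ℂ) k)
  refine ⟨f, fun K hKL hK => ?_⟩
  let r : C(L, ℂ) → C(K, ℂ) := fun u => u.comp ⟨Set.inclusion hKL, continuous_inclusion hKL⟩
  have hr : Function.Surjective r := fun v => by
    obtain ⟨w, hw⟩ := ContinuousMap.exists_restrict_eq hK v
    exact ⟨w.restrict L, hw⟩
  convert hr.denseRange.comp (TopologicalSpace.denseRange_denseSeq C(L, ℂ))
    (ContinuousMap.continuous_precomp _) using 2 with k
  simp only [r, Function.comp, ← hf]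
  rfl

theorem continuous_apply_apply_of_discrete {X Q Y : Type*} [TopologicalSpace X]
    [TopologicalSpace Q] [DiscreteTopology Q] [TopologicalSpace Y] {π : X → Q} (hπ : Continuous π)
    (φ : Q → C(X, Y)) : Continuous fun z => φ (π z) z := by
  have : Continuous fun p : Q × X => φ p.1 p.2 :=
    continuous_prod_of_discrete_left.2 fun q => (φ q).continuous
  exact this.comp (hπ.prodMk continuous_id)

/-- Functions on the whole group can be prescribed independently on the translates by `-x i` of the
preimages of the sets `F i` in a discrete quotient, provided that these translates are disjoint. -/
theorem exists_continuousMap_translates {G Q ι Y : Type*} [AddCommGroup G] [TopologicalSpace G]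
    [IsTopologicalAddGroup G] [AddCommGroup Q] [TopologicalSpace Q] [DiscreteTopology Q]
    [TopologicalSpace Y] [Nonempty Y]
    (π : G →+ Q) (hπ : Continuous π) (F : ι → Set Q) (x : ι → G)
    (hx : ∀ i j z, z + π (x i) ∈ F i → z + π (x j) ∈ F j → i = j) (h : ι → C(G, Y)) :
    ∃ g : C(G, Y), ∀ i y, π y ∈ F i → g (y - x i) = h i y := by
  classical
  -- The coset `q` lies in at most one of the translates, and there `g` is the corresponding `h i`.
  let φ (q : Q) : C(G, Y) :=
    if hq : ∃ i, q + π (x i) ∈ F i then (h hq.choose).comp (ContinuousMap.addRight (x hq.choose))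
    else .const G (Classical.arbitrary Y)
  refine ⟨⟨_, continuous_apply_apply_of_discrete hπ φ⟩, fun i y hy => ?_⟩
  have hi : π (y - x i) + π (x i) ∈ F i := by rwa [← map_add, sub_add_cancel]
  have hq : ∃ i', π (y - x i) + π (x i') ∈ F i' := ⟨i, hi⟩
  have hc : hq.choose = i := hx _ _ _ hq.choose_spec hi
  simp only [ContinuousMap.coe_mk, φ, dif_pos hq, hc]
  simp

theorem isCompact_preimage_mk_of_finite {G : Type*} [AddCommGroup G] [TopologicalSpace G]
    [IsTopologicalAddGroup G] {H : AddSubgroup G} (hH : IsCompact (H : Set G))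
    {F : Set (G ⧸ H)} (hF : F.Finite) :
    IsCompact ((QuotientAddGroup.mk : G → G ⧸ H) ⁻¹' F) := by
  rw [← Set.biUnion_preimage_singleton]
  refine hF.isCompact_biUnion fun q _ => ?_
  obtain ⟨a, rfl⟩ := QuotientAddGroup.mk_surjective q
  convert hH.vadd a using 1
  ext y
  simp [Set.mem_vadd_set_iff_neg_vadd_mem, eq_comm (a := (y : G ⧸ H)), QuotientAddGroup.eq]

/-- A polarization identity that isolates the part of `conj (1 + a) * (1 + b)` antilinear in `a` and
independent of `b`. -/
theorem Complex.sum_I_pow_mul_conj_mul (a b : ℂ) :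
    ∑ j : Fin 4, I ^ (j : ℕ) * ((starRingEnd ℂ) (1 + I ^ (j : ℕ) * a) * (1 + I ^ (j : ℕ) * b)) =
      4 * (starRingEnd ℂ) a := by
  simp only [Fin.sum_univ_four, map_add, map_mul, map_pow, map_one, conj_I, Fin.isValue,
    Fin.coe_ofNat_eq_mod, I_pow_three, I_sq, neg_sq, neg_pow I 3, pow_zero, pow_one, Nat.reduceMod]
  ring_nf
  rw [I_sq]
  ring

theorem mainTheorem3 {G : Type*} [AddCommGroup G] [TopologicalSpace G] [IsTopologicalAddGroup G]
    [LocallyCompactSpace G] [T2Space G] [FirstCountableTopology G] [NoncompactSpace G]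
    (H : AddSubgroup G) (hHopen : IsOpen (H : Set G)) (hHcompact : IsCompact (H : Set G))
    (hHproper : H ≠ ⊤) :
    ∃ (g : C(G, ℂ)) (Λ : Set G), IsUniformlySeparated Λ ∧
      (∀ K : Set G, IsCompact K → K ⊆ (H : Set G) → ∀ s ∈ K - K,
        IsCompleteOn (fun x : Λ => translateMap (x : G) (windowProduct g s)) K) ∧
      (IsDuallyExpansible G → ∀ K : Set G, IsCompact K → ∀ s ∈ K - K,
        IsCompleteOn (fun x : Λ => translateMap (x : G) (windowProduct g s)) K) := by
  classical
  -- Completeness holds on every compact `K` and for every `s`, so one pair `g`, `Λ` serves both parts.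
  suffices h : ∃ (g : C(G, ℂ)) (Λ : Set G), IsUniformlySeparated Λ ∧
      ∀ K : Set G, IsCompact K → ∀ s : G,
        IsCompleteOn (fun x : Λ => translateMap (x : G) (windowProduct g s)) K by
    obtain ⟨g, Λ, hΛ, h⟩ := h
    exact ⟨g, Λ, hΛ, fun K hK _ s _ => h K hK s, fun _ K hK s _ => h K hK s⟩
  have : TopologicalSpace.MetrizableSpace G := by
    let _ := IsTopologicalAddGroup.rightUniformSpace G
    have := isUniformAddGroup_of_addCommGroup (G := G)
    have := IsUniformAddGroup.uniformity_countably_generated (α := G)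
    exact UniformSpace.metrizableSpace
  have : DiscreteTopology (G ⧸ H) := QuotientAddGroup.discreteTopology hHopen
  have hcpt {F : Set (G ⧸ H)} (hF : F.Finite) := isCompact_preimage_mk_of_finite hHcompact hF
  have : Infinite (G ⧸ H) := not_finite_iff_infinite.1 fun _ =>
    noncompact_univ G (by simpa using hcpt (Set.finite_univ))
  choose f hf using fun F : Finset (G ⧸ H) =>
    ContinuousMap.exists_seq_denseRange_restrict (hcpt F.finite_toSet)
  -- One index for each finite set of cosets, each member of the dense sequence over it, and each
  -- term of the polarization identity.
  have hcard : Cardinal.mk (Finset (G ⧸ H) × ℕ × Fin 4) ≤ Cardinal.mk (G ⧸ H) := by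
    simp
  obtain ⟨q, hqinj, hq⟩ := exists_injective_sub_disjoint hcard fun i => i.1
  choose x hx using fun i => QuotientAddGroup.mk'_surjective H (q i)
  obtain ⟨g, hg⟩ := exists_continuousMap_translates (QuotientAddGroup.mk' H)
    QuotientAddGroup.continuous_mk (fun i : Finset (G ⧸ H) × ℕ × Fin 4 => (i.1 : Set (G ⧸ H))) x
    (by simpa only [hx, Finset.mem_coe] using hq)
    fun i => 1 + Complex.I ^ (i.2.2 : ℕ) • star (f i.1 i.2.1)
  refine ⟨g, Set.range x, ⟨H, hHopen.mem_nhds H.zero_mem, ?_⟩, fun K hK s => ?_⟩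
  · rintro a _ ⟨hi, i, rfl⟩ _ ⟨hj, j, rfl⟩
    have hmk {y : G} (hy : y ∈ a +ᵥ (H : Set G)) : QuotientAddGroup.mk' H y = a := by
      rw [Set.mem_vadd_set_iff_neg_vadd_mem] at hy
      exact (QuotientAddGroup.eq.2 hy).symm
    rw [hqinj ((hx i).symm.trans ((hmk hi).trans ((hmk hj).symm.trans (hx j))))]
  -- The values of `g_s (y - x)` for `y ∈ K` involve `g` at `y - x` and at `y - s - x`, so both `K` and
  -- `K - s` have to lie over `F`.
  obtain ⟨F, hF⟩ : ∃ F : Finset (G ⧸ H), ∀ y ∈ K,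
      QuotientAddGroup.mk' H y ∈ F ∧ QuotientAddGroup.mk' H (y - s) ∈ F := by
    have hfin : (QuotientAddGroup.mk' H '' (K ∪ (· - s) '' K)).Finite :=
      ((hK.union (hK.image (by fun_prop))).image QuotientAddGroup.continuous_mk).finite_of_discrete
    refine ⟨hfin.toFinset, fun y hy => ?_⟩
    rw [hfin.mem_toFinset, hfin.mem_toFinset]
    exact ⟨Set.mem_image_of_mem _ (.inl hy),
      Set.mem_image_of_mem _ (.inr (Set.mem_image_of_mem _ hy))⟩
  have hdense := hf F K (fun y hy => (hF y hy).1) hK.isClosed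
  refine Submodule.dense_iff_topologicalClosure_eq_top.1 (hdense.mono ?_)
  rintro _ ⟨k, rfl⟩
  have hcomb : (f F k).restrict K = (4 : ℂ)⁻¹ • ∑ j : Fin 4, Complex.I ^ (j : ℕ) •
      (translateMap (x (F, k, j)) (windowProduct g s)).restrict K := by
    ext ⟨y, hy⟩
    have h₁ (j : Fin 4) := hg (F, k, j) y (hF y hy).1
    have h₂ (j : Fin 4) := hg (F, k, j) (y - s) (hF y hy).2
    have := Complex.sum_I_pow_mul_conj_mul (star (f F k y)) (star (f F k (y - s)))
    simp_all [translateMap, windowProduct, sub_right_comm y _ s]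
  beta_reduce
  rw [hcomb]
  exact Submodule.smul_mem _ _ (Submodule.sum_mem _ fun j _ => Submodule.smul_mem _ _
    (Submodule.subset_span ⟨⟨x (F, k, j), Set.mem_range_self _⟩, rfl⟩))
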